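/- Let $\mathbf B=\langle B,F_B\rangle$ be a finite unary algebra, let $K\ge 2$, $u\ge 1$, let $a_1,\dots,a_{K-1},b_1,\dots,b_{K-1}\in B$, let $\beta=\mathrm{Cg}^{\mathbf B}((a_1,b_1),\dots,(a_{K-1},b_{K-1}))$, and let $\mathscr T=|\mathscr T_1|\cdots|\mathscr T_N|$ be a partition of $\{0,K,2K,\dots,uK\}$ into non-empty blocks. Take copies $B_0=B,B_1,\dots,B_{uK}$ of $B$, with bijections $x\mapsto x^i$ of $B$ onto $B_i$ ($x^0=x$), that overlap only as follows. The left and right tie-points of $B_i$ are both $a_1^i$ if $K\mid i$, and are $a_p^i$ and $b_p^i$ if $i=\ell+p$ with $K\mid\ell$ and $1\le p<K$; for $0\le i<uK$ the right tie-point of $B_i$ is identified with the left tie-point of $B_{i+1}$. Let $A=B_0\cup\dots\cup B_{uK}$ and let $S_{i,j}:B_i\to B_j$ be the bijection $x^i\mapsto x^j$. For $\ell\in\mathscr T_n$, let $e_\ell(x)=S_{j,\ell}(x)$ if $x\in B_j$ for some $j\in\mathscr T_n$, and $e_\ell(x)=a_1^\ell$ otherwise. For $i=\ell+p$ with $K\mid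 \ell$, $0\le\ell<uK$ and $1\le p<K$, let $e_i(x)=a_p^i$ if $x\in B_j$ for some $j<i$, $e_i(x)=x$ if $x\in B_i$, and $e_i(x)=b_p^i$ if $x\in B_j$ for some $j>i$. Put $q_{i,j}=S_{i,j}\circ e_i$ and \[F_A=\{fe_0: f\in F_B\}\cup\{q_{i,0}:0\le i\le uK\}\cup\{q_{0,j}:1\le j\le uK\},\qquad \mathbf A=\langle A,F_A\rangle.\] For $\theta\in\mathrm{Con}\,\mathbf B$ let $\theta^*=\mathrm{Cg}^{\mathbf A}(\theta)$ and $\widehat\theta=\{(x,y)\in A^2: (e_0f(x),e_0f(y))\in\theta \text{ for all } f\in \mathrm{Pol}_1(\mathbf A)\}$, where $\mathrm{Pol}_1(\mathbf A)$ is the set of unary polynomial operations of $\mathbf A$. Let $\theta\in\mathrm{Con}\,\mathbf B$ have $r$ congruence classes, and let $1_B$ be the greatest congruence of $\mathbf B$. Then: 1. If $\theta^*<\widehat\theta$, then $\beta\le\theta<1_B$. If at least one block of $\mathscr T$ has two or more elements, then $\theta^*<\widehat\theta$ if and only if $\beta\le\theta<1_B$. 2. If $\beta\le\theta<1_B$,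 then the interval $[\theta^*,\widehat\theta]$ of $\mathrm{Con}\,\mathbf A$ is isomorphic to $\prod_{n=1}^N(\mathrm{Eq}|\mathscr T_n|)^{r-1}$, where $\mathrm{Eq}(k)$ is the lattice of equivalence relations on a $k$-element set. 3. If $\theta\not\ge\beta$, then $\theta^*=\widehat\theta$. -/

import Mathlib

section Overalgebra

/-! ## Unary algebras and their congruence lattices -/

/-- `Con ⟨X, F⟩` for the unary algebra with universe `X` and set of basic operations `F`:
the equivalence relations on `X` that are preserved by every operation in `F`. -/
def UCon {X : Type*} (F : Set (X → X)) : Type _ :=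
  {s : Setoid X // ∀ f ∈ F, ∀ x y, s x y → s (f x) (f y)}

namespace UCon

variable {X : Type*} {F : Set (X → X)}

/-- Congruences are ordered by inclusion. -/
instance : PartialOrder (UCon F) := Subtype.partialOrder _

/-- Intersection of a family of congruences. -/
instance : InfSet (UCon F) where
  sInf S := ⟨sInf (Subtype.val '' S), by
    intro f hf x y h t ht
    obtain ⟨s, hs, rfl⟩ := ht
    exact s.2 f hf x y (h _ (Set.mem_image_of_mem _ hs))⟩

theorem isGLB_sInf (S : Set (UCon F)) : IsGLB S (sInf S) := by
  constructor
  · intro t ht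
    exact sInf_le (Set.mem_image_of_mem Subtype.val ht)
  · intro t ht
    refine le_sInf (α := Setoid X) ?_
    rintro _ ⟨s, hs, rfl⟩
    exact ht hs

/-- The congruence lattice; its top element is the total relation. -/
instance : CompleteLattice (UCon F) :=
  { completeLatticeOfInf (UCon F) isGLB_sInf with
    top := ⟨⊤, fun _ _ _ _ _ => trivial⟩
    le_top := fun s => (le_top : s.1 ≤ ⊤) }

/-- The number of congruence classes. -/
noncomputable def numClasses (θ : UCon F) : ℕ := Nat.card (Quotient θ.1)

end UCon

/-- `Cg^⟨X, F⟩(R)`: the least congruence containing the relation `R`. -/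
def Cg {X : Type*} (F : Set (X → X)) (R : X → X → Prop) : UCon F :=
  sInf {s : UCon F | ∀ x y, R x y → s.1 x y}

/-- `Pol₁ ⟨X, F⟩`: the unary members of the clone generated by the (unary) operations in `F` and the
constant maps.  As all generators are unary, these are the maps obtained from the identity and the
constants by composing with operations in `F` on the left. -/
inductive Pol₁ {X : Type*} (F : Set (X → X)) : (X → X) → Prop
  | id : Pol₁ F (fun x => x)
  | const (c : X) : Pol₁ F (fun _ => c)
  | comp (f : X → X) (hf : f ∈ F) (g : X → X) (hg : Pol₁ F g) : Pol₁ F (fun x => f (g x))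

theorem Pol₁.comp_right {X : Type*} {F : Set (X → X)} {p : X → X} (hp : Pol₁ F p)
    {f : X → X} (hf : f ∈ F) : Pol₁ F (fun x => p (f x)) := by
  induction hp with
  | id => exact .comp f hf _ .id
  | const c => exact .const c
  | comp g hg h _ ih => exact .comp g hg _ ih

/-! ## The overalgebra -/

/-- The input of the construction: the operations of the unary base algebra `⟨B, F⟩`, the numbers
`K` and `u`, the pairs `(a 1, b 1), …, (a (K - 1), b (K - 1))` (the values of `a` and `b` at other
indices are never used), and a partition of the set of indices `{0, K, 2K, …, uK}`. -/
structure LampeData (B : Type*) where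
  /-- the basic operations of the base algebra -/
  F : Set (B → B)
  K : ℕ
  two_le_K : 2 ≤ K
  u : ℕ
  one_le_u : 1 ≤ u
  a : ℕ → B
  b : ℕ → B
  /-- the partition of `{0, K, 2K, …, uK}` -/
  T : Finpartition ((Finset.range (u + 1)).image (fun v => v * K))

namespace LampeData

variable {B : Type*} (D : LampeData B)

/-- The congruence `β = Cg^B((a₁, b₁), …, (a_{K-1}, b_{K-1}))` of the base algebra. -/
def beta : UCon D.F :=
  Cg D.F (fun x y => ∃ i, 1 ≤ i ∧ i < D.K ∧ x = D.a i ∧ y = D.b i)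

/-- The indices `0, …, uK` of the copies of `B`. -/
abbrev Idx : Type := Fin (D.u * D.K + 1)

/-- The element of `B` whose copy in `B_i` is the left tie-point of `B_i`: it is `a₁` if `K ∣ i`, and
`a_p` if `i = ℓ + p` with `K ∣ ℓ` and `1 ≤ p < K`. -/
def left (i : ℕ) : B := if D.K ∣ i then D.a 1 else D.a (i % D.K)

/-- The element of `B` whose copy in `B_i` is the right tie-point of `B_i`: it is `a₁` if `K ∣ i`, and
`b_p` if `i = ℓ + p` with `K ∣ ℓ` and `1 ≤ p < K`. -/
def right (i : ℕ) : B := if D.K ∣ i then D.a 1 else D.b (i % D.K)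

/-- Generating identifications on the disjoint union of the copies `B_i = {i} × B`: the right
tie-point of `B_i` is the left tie-point of `B_{i+1}`. -/
inductive Glue : D.Idx × B → D.Idx × B → Prop
  | step (i : ℕ) (h : i + 1 < D.u * D.K + 1) :
      Glue (⟨i, Nat.lt_of_succ_lt h⟩, D.right i) (⟨i + 1, h⟩, D.left (i + 1))

/-- The universe `A = B_0 ∪ ⋯ ∪ B_{uK}`: the copies of `B`, glued along the tie-points. -/
def A : Type _ := Quot D.Glue

/-- `D.copy i x` is `x^i`, the element of `B_i` that corresponds to `x`; so `D.copy i` is the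
bijection of `B` onto `B_i`, and `D.copy 0` identifies `B` with `B_0`. -/
def copy (i : D.Idx) (x : B) : D.A := Quot.mk _ (i, x)

/-- `B_i` as a subset of `A`. -/
def sub (i : D.Idx) : Set D.A := Set.range (D.copy i)

/-- `i` and `j` are multiples of `K` in the same block of the partition. -/
def SameBlock (i j : ℕ) : Prop := ∃ P ∈ D.T.parts, i ∈ P ∧ j ∈ P

open scoped Classical in
/-- The element of `B` whose copy in `B_i` is the value of `e_i` at `x^j`. -/
noncomputable def coordAux (i j : ℕ) (x : B) : B :=
  if D.K ∣ i then
    if D.SameBlock i j then x else D.a 1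
  else
    if j < i then D.a (i % D.K) else if j = i then x else D.b (i % D.K)

theorem SameBlock.dvd {D : LampeData B} {i j : ℕ} (h : D.SameBlock i j) : D.K ∣ j := by
  obtain ⟨P, hP, -, hj⟩ := h
  have := D.T.le hP hj
  simp only [Finset.mem_image] at this
  obtain ⟨v, -, rfl⟩ := this
  exact Dvd.intro_left v rfl

theorem sameBlock_self {v : ℕ} (hv : v ≤ D.u) : D.SameBlock (v * D.K) (v * D.K) := by
  have h : v * D.K ∈ (Finset.range (D.u + 1)).image (fun v => v * D.K) :=
    Finset.mem_image_of_mem _ (Finset.mem_range.2 (Nat.lt_succ_of_le hv))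
  obtain ⟨P, hP, h'⟩ := D.T.exists_mem h
  exact ⟨P, hP, h', h'⟩

open scoped Classical in
theorem coordAux_glue (i j : ℕ) :
    D.coordAux i j (D.right j) = D.coordAux i (j + 1) (D.left (j + 1)) := by
  unfold coordAux
  by_cases hi : D.K ∣ i
  · rw [if_pos hi, if_pos hi]
    have h1 : (if D.SameBlock i j then D.right j else D.a 1) = D.a 1 := by
      split_ifs with h
      · simp [right, h.dvd]
      · rfl
    have h2 : (if D.SameBlock i (j + 1) then D.left (j + 1) else D.a 1) = D.a 1 := by
      split_ifs with h
      · simp [left, h.dvd]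
      · rfl
    rw [h1, h2]
  · rw [if_neg hi, if_neg hi]
    rcases lt_trichotomy j i with h | rfl | h
    · rcases Nat.lt_or_eq_of_le (Nat.succ_le_of_lt h) with h' | h'
      · rw [if_pos h, if_pos h']
      · have h' : j + 1 = i := h'
        subst h'
        simp [left, hi]
    · simp [right, hi]
    · rw [if_neg (by omega), if_neg (by omega), if_neg (by omega), if_neg (by omega)]

/-- `e_i` followed by the inverse of the bijection `D.copy i : B → B_i`. -/
noncomputable def coord (i : D.Idx) : D.A → B :=
  Quot.lift (fun p => D.coordAux i p.1 p.2) (by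
    rintro _ _ ⟨j, h⟩
    exact D.coordAux_glue i j)

/-- The maps `e_i : A → A`. -/
noncomputable def e (i : D.Idx) (x : D.A) : D.A := D.copy i (D.coord i x)

theorem coord_copy (i : D.Idx) (x : B) : D.coord i (D.copy i x) = x := by
  change D.coordAux i i x = x
  unfold coordAux
  split_ifs with h h' h' h'
  · rfl
  · exfalso
    obtain ⟨v, hv⟩ := h
    apply h'
    rw [hv, Nat.mul_comm]
    apply D.sameBlock_self
    have h1 := i.2
    rw [hv] at h1
    have hK := D.two_le_K
    by_contra hlt
    have : D.K * (D.u + 1) ≤ D.K * v := Nat.mul_le_mul_left _ (by omega)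
    rw [Nat.mul_comm D.u] at h1
    rw [Nat.mul_add] at this
    omega
  · omega
  · rfl
  · exact absurd rfl h'

theorem copy_injective (i : D.Idx) : Function.Injective (D.copy i) :=
  Function.LeftInverse.injective (D.coord_copy i)

theorem e_copy_of_dvd {i : D.Idx} (hi : D.K ∣ (i : ℕ)) (j : D.Idx) (x : B) :
    (D.SameBlock i j → D.e i (D.copy j x) = D.copy i x) ∧
      (¬ D.SameBlock i j → D.e i (D.copy j x) = D.copy i (D.a 1)) := by
  constructor <;> intro h <;>
    exact congrArg (D.copy i) (by change D.coordAux i j x = _; simp [coordAux, hi, h])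

theorem e_copy_of_not_dvd {i : D.Idx} (hi : ¬ D.K ∣ (i : ℕ)) (j : D.Idx) (x : B) :
    (j < i → D.e i (D.copy j x) = D.copy i (D.a (i % D.K))) ∧
      (j = i → D.e i (D.copy j x) = D.copy j x) ∧
      (i < j → D.e i (D.copy j x) = D.copy i (D.b (i % D.K))) := by
  refine ⟨fun h => ?_, ?_, fun h => ?_⟩
  · have h : (j : ℕ) < i := h
    exact congrArg (D.copy i) (by change D.coordAux i j x = _; simp [coordAux, hi, h])
  · rintro rfl
    exact congrArg (D.copy j) (D.coord_copy j x)
  · have h : (i : ℕ) < j := h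
    exact congrArg (D.copy i) (by
      change D.coordAux i j x = _
      simp [coordAux, hi, Nat.not_lt_of_lt h, Nat.ne_of_gt h])

/-- For `i < j`, the copies `B_i` and `B_j` meet at most in tie-points, and only if the two
tie-points of each copy strictly between them coincide. -/
theorem copy_eq_copy {i j : D.Idx} (hij : i < j) {x y : B} (h : D.copy i x = D.copy j y) :
    x = D.right i ∧ y = D.left j ∧ ∀ k : ℕ, (i : ℕ) < k → k < j → D.left k = D.right k := by
  have key : ∀ k : ℕ, (if (i : ℕ) < k then D.left k else if (i : ℕ) = k then x else D.right k) =
      (if (j : ℕ) < k then D.left k else if (j : ℕ) = k then y else D.right k) := fun k =>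
    congrArg (Quot.lift (fun p : D.Idx × B =>
        if (p.1 : ℕ) < k then D.left k else if (p.1 : ℕ) = k then p.2 else D.right k) (by
      rintro _ _ ⟨l, hl⟩
      dsimp only
      rcases lt_trichotomy l k with h' | rfl | h'
      · rcases Nat.lt_or_eq_of_le (Nat.succ_le_of_lt h') with h'' | h''
        · rw [if_pos h', if_pos h'']
        · have h'' : l + 1 = k := h''
          subst h''
          simp
      · simp
      · rw [if_neg (by omega), if_neg (by omega), if_neg (by omega), if_neg (by omega)])) h
  have hij : (i : ℕ) < j := hij
  refine ⟨?_, ?_, fun k h1 h2 => ?_⟩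
  · have := key i
    simpa [Nat.not_lt_of_lt hij, Nat.ne_of_gt hij] using this
  · have := key j
    simpa [hij] using this.symm
  · have := key k
    simpa [h1, Nat.not_lt_of_lt h2, Nat.ne_of_gt h2] using this

/-- `q_{i,j} = S_{i,j} ∘ e_i`, where `S_{i,j} : B_i → B_j` is the bijection `x^i ↦ x^j`. -/
noncomputable def q (i j : D.Idx) (x : D.A) : D.A := D.copy j (D.coord i x)

/-- The basic operations of the overalgebra `⟨A, F_A⟩`:
`f e_0` for `f` a basic operation of the base algebra, all `q_{i,0}`, and `q_{0,j}` for `1 ≤ j`. -/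
def FA : Set (D.A → D.A) :=
  {g | ∃ f ∈ D.F, g = fun x => D.copy 0 (f (D.coord 0 x))} ∪
    {g | ∃ i : D.Idx, g = D.q i 0} ∪ {g | ∃ j : D.Idx, 1 ≤ (j : ℕ) ∧ g = D.q 0 j}

/-- `θ* = Cg^A(θ)`. -/
def star (θ : UCon D.F) : UCon D.FA :=
  Cg D.FA (fun x y => ∃ s t : B, θ.1 s t ∧ x = D.copy 0 s ∧ y = D.copy 0 t)

/-- `θ̂ = {(x, y) ∈ A² : (e_0 f(x), e_0 f(y)) ∈ θ for all f ∈ Pol₁(A)}`, where `B_0` is identified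
with `B`. -/
def hat (θ : UCon D.F) : UCon D.FA :=
  ⟨{ r := fun x y => ∀ f, Pol₁ D.FA f → θ.1 (D.coord 0 (f x)) (D.coord 0 (f y))
     iseqv :=
      ⟨fun _ _ _ => θ.1.refl' _, fun h f hf => θ.1.symm' (h f hf),
        fun h h' f hf => θ.1.trans' (h f hf) (h' f hf)⟩ },
    fun _ hg _ _ h _ hf => h _ (hf.comp_right hg)⟩

end LampeData

end Overalgebra

/-!
Write `θ` for the given congruence of the base algebra. Two points of `A` are `θ̂`-related iff all
their coordinates are `θ`-related (`LampeData.hat_iff`), because every transition map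
`coord k ∘ copy i` is the identity or constant. For the same reason every basic operation sends a
`θ̂`-related pair to a pair `s^k, t^k` with `(s, t) ∈ θ` (`LampeData.exists_copy_of_mem_FA`). Hence
`θ*` is the equivalence relation generated by the copies of `θ`, and *every* equivalence relation
between `θ*` and `θ̂` is a congruence (`LampeData.conOfBetween`).

Suppose that `x^i` and `y^j` with `i < j` are `θ̂`-related. If `i` and `j` are not in the same block,
the coordinates from `i` to `j` say that one can walk along the chain of copies from `x^i` to `y^j`
within `θ*`; otherwise the coordinate at `i` says that `x` and `y` are `θ`-related
(`LampeData.star_or_sameBlock_of_hat`). In the second case `j - i ≥ K`, and the coordinates strictly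
between `i` and `j` force `β ≤ θ`; so `θ* = θ̂` if `β ≰ θ`.

If `β ≤ θ`, all tie-points are in a single class of `θ*`, and modulo `θ*` the algebra is a wedge of
copies of `B/θ` (`LampeData.star_copy_cases`). Then `θ̂` also relates `x^i` to `x^j` for `i`, `j` in
the same block, which is new exactly when `x` is not in the class of `a₁`. So an equivalence relation
in the interval amounts to an equivalence relation on each block for each of the other `r - 1` classes.
-/

namespace UCon

theorem Cg_of {X : Type*} {F : Set (X → X)} {R : X → X → Prop} {x y : X} (h : R x y) :
    (Cg F R).1 x y := by
  rintro _ ⟨s, hs, rfl⟩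
  exact hs x y h

theorem Cg_le {X : Type*} {F : Set (X → X)} {R : X → X → Prop} {s : UCon F}
    (h : ∀ x y, R x y → s.1 x y) : Cg F R ≤ s :=
  sInf_le h

end UCon

namespace LampeData

variable {B : Type*} {D : LampeData B} {θ : UCon D.F}

/-! ### The relations `θ*` and `θ̂` -/

theorem exists_copy (z : D.A) : ∃ i x, z = D.copy i x := by
  obtain ⟨⟨i, x⟩, rfl⟩ := Quot.exists_rep z
  exact ⟨i, x, rfl⟩

theorem coord_copy_eq (k i : D.Idx) (x : B) : D.coord k (D.copy i x) = D.coordAux k i x := rfl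

theorem coordAux_rel (k i : ℕ) {x y : B} (h : θ.1 x y) :
    θ.1 (D.coordAux k i x) (D.coordAux k i y) := by
  unfold coordAux
  split_ifs <;> first | exact h | exact θ.1.refl' _

theorem exists_copy_of_mem_FA {g : D.A → D.A} (hg : g ∈ D.FA) {x y : D.A}
    (h : ∀ k, θ.1 (D.coord k x) (D.coord k y)) :
    ∃ k s t, θ.1 s t ∧ g x = D.copy k s ∧ g y = D.copy k t := by
  rcases hg with (⟨f, hf, rfl⟩ | ⟨i, rfl⟩) | ⟨j, -, rfl⟩
  · exact ⟨0, _, _, θ.2 f hf _ _ (h 0), rfl, rfl⟩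
  · exact ⟨0, _, _, h i, rfl, rfl⟩
  · exact ⟨j, _, _, h 0, rfl, rfl⟩

/-- The polynomials `q_{k,0}` show that `θ̂`-related points have `θ`-related coordinates. Conversely,
that property is preserved by the basic operations, hence by all unary polynomials. -/
theorem hat_iff {x y : D.A} :
    (D.hat θ).1 x y ↔ ∀ k, θ.1 (D.coord k x) (D.coord k y) := by
  constructor
  · intro h k
    have := h _ (.comp (D.q k 0) (.inl (.inr ⟨k, rfl⟩)) _ .id)
    simpa only [q, coord_copy] using this
  · intro h f hf
    suffices ∀ k, θ.1 (D.coord k (f x)) (D.coord k (f y)) from this 0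
    induction hf with
    | id => exact h
    | const c => exact fun _ => θ.1.refl' _
    | comp g hg p _ ih =>
      obtain ⟨k, s, t, hst, h1, h2⟩ := exists_copy_of_mem_FA hg ih
      intro l
      dsimp only
      rw [h1, h2]
      exact coordAux_rel l k hst

/-- An equivalence relation that contains the copies of `θ` and lies below `θ̂` is a congruence. -/
def conOfBetween (η : Setoid D.A) (h₁ : ∀ k s t, θ.1 s t → η (D.copy k s) (D.copy k t))
    (h₂ : ∀ x y, η x y → (D.hat θ).1 x y) : UCon D.FA :=
  ⟨η, fun _ hg x y h => by
    obtain ⟨k, s, t, hst, e₁, e₂⟩ := exists_copy_of_mem_FA hg (hat_iff.1 (h₂ x y h))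
    rw [e₁, e₂]
    exact h₁ k s t hst⟩

theorem star_copy (k : D.Idx) {s t : B} (h : θ.1 s t) :
    (D.star θ).1 (D.copy k s) (D.copy k t) := by
  have h0 : (D.star θ).1 (D.copy 0 s) (D.copy 0 t) := UCon.Cg_of ⟨s, t, h, rfl, rfl⟩
  by_cases hk : 1 ≤ (k : ℕ)
  · have := (D.star θ).2 (D.q 0 k) (.inr ⟨k, hk, rfl⟩) _ _ h0
    simpa only [q, coord_copy] using this
  · obtain rfl : k = 0 := Fin.ext (by simpa using hk)
    exact h0

theorem star_le {η : UCon D.FA} (h : ∀ k s t, θ.1 s t → η.1 (D.copy k s) (D.copy k t)) :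
    D.star θ ≤ η :=
  UCon.Cg_le (by rintro _ _ ⟨s, t, hst, rfl, rfl⟩; exact h 0 s t hst)

theorem star_le_hat : D.star θ ≤ D.hat θ :=
  star_le fun k _ _ h => hat_iff.2 fun l => coordAux_rel l k h

/-! ### Walking along the chain of copies -/

theorem glue_copy {i j : D.Idx} (h : (j : ℕ) = i + 1) :
    D.copy i (D.right i) = D.copy j (D.left j) := by
  obtain ⟨i, hi⟩ := i
  obtain ⟨j, hj⟩ := j
  obtain rfl : j = i + 1 := h
  exact Quot.sound (.step i hj)

/-- If the two tie-points of every copy strictly between `B_i` and `B_j` are `θ`-related, then `θ*`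
relates the facing tie-points of `B_i` and `B_j`. -/
theorem star_right_left {i j : D.Idx} (hij : (i : ℕ) < j)
    (h : ∀ k : ℕ, (i : ℕ) < k → k < j → θ.1 (D.left k) (D.right k)) :
    (D.star θ).1 (D.copy i (D.right i)) (D.copy j (D.left j)) := by
  obtain ⟨j, hj⟩ := j
  dsimp only at hij h ⊢
  induction j with
  | zero => omega
  | succ n ih =>
    rcases Nat.lt_or_eq_of_le (Nat.le_of_lt_succ hij) with hn | hn
    · have h1 := ih (by omega) hn fun k h1 h2 => h k h1 (by omega)
      refine (D.star θ).1.trans' h1 ?_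
      rw [← glue_copy (i := ⟨n, by omega⟩) (j := ⟨n + 1, hj⟩) rfl]
      exact star_copy _ (h n hn (by omega))
    · rw [glue_copy (i := i) (j := ⟨n + 1, hj⟩) (by simp [hn])]

/-- If the two tie-points of every copy are `θ`-related, then `θ*` relates all points that are
`θ`-related to a tie-point of their copy. -/
theorem star_of_rel_left (hLR : ∀ k, θ.1 (D.left k) (D.right k)) {i j : D.Idx} {x y : B}
    (hx : θ.1 x (D.left i)) (hy : θ.1 y (D.left j)) :
    (D.star θ).1 (D.copy i x) (D.copy j y) := by
  have key : ∀ {i j : D.Idx}, i < j →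
      (D.star θ).1 (D.copy i (D.left i)) (D.copy j (D.left j)) := fun {i j} hij =>
    (D.star θ).1.trans' (star_copy i (hLR i)) (star_right_left hij fun k _ _ => hLR k)
  refine (D.star θ).1.trans' (star_copy i hx) ((D.star θ).1.trans' ?_ (star_copy j (θ.1.symm' hy)))
  rcases lt_trichotomy i j with h | rfl | h
  · exact key h
  · exact (D.star θ).1.refl' _
  · exact (D.star θ).1.symm' (key h)

theorem SameBlock.symm {i j : ℕ} (h : D.SameBlock i j) : D.SameBlock j i := by
  obtain ⟨P, hP, hi, hj⟩ := h
  exact ⟨P, hP, hj, hi⟩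

theorem left_eq_right {k : ℕ} (h : D.K ∣ k) : D.left k = D.right k := by
  simp [left, right, h]

theorem rel_left_right_of_hat {i j : D.Idx} {x y : B}
    (h : (D.hat θ).1 (D.copy i x) (D.copy j y)) {k : ℕ} (hik : (i : ℕ) < k) (hkj : k < j) :
    θ.1 (D.left k) (D.right k) := by
  by_cases hk : D.K ∣ k
  · rw [left_eq_right hk]
  · have := hat_iff.1 h ⟨k, hkj.trans j.2⟩
    rw [coord_copy_eq, coord_copy_eq] at this
    simpa [coordAux, left, right, hk, hik, hkj.not_gt, hkj.ne'] using this

theorem star_or_sameBlock_of_hat {i j : D.Idx} {x y : B}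
    (h : (D.hat θ).1 (D.copy i x) (D.copy j y)) :
    (D.star θ).1 (D.copy i x) (D.copy j y) ∨ (D.SameBlock i j ∧ θ.1 x y) := by
  have key : ∀ {i j : D.Idx} {x y : B}, i < j → (D.hat θ).1 (D.copy i x) (D.copy j y) →
      (D.star θ).1 (D.copy i x) (D.copy j y) ∨ (D.SameBlock i j ∧ θ.1 x y) := by
    intro i j x y hij h
    have hij : (i : ℕ) < j := hij
    have hi := hat_iff.1 h i
    have hj := hat_iff.1 h j
    rw [coord_copy] at hi hj
    rw [coord_copy_eq] at hi hj
    by_cases hs : D.SameBlock i j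
    · exact .inr ⟨hs, by simpa [coordAux, hs, hs.symm.dvd] using hi⟩
    · have hs' : ¬ D.SameBlock j i := fun h => hs h.symm
      have hx : θ.1 x (D.right i) := by
        by_cases hd : D.K ∣ i
        · simpa [coordAux, right, hd, hs] using hi
        · simpa [coordAux, right, hd, hij.not_gt, hij.ne'] using hi
      have hy : θ.1 (D.left j) y := by
        by_cases hd : D.K ∣ j
        · simpa [coordAux, left, hd, hs'] using hj
        · simpa [coordAux, left, hd, hij] using hj
      exact .inl ((D.star θ).1.trans' (star_copy i hx) ((D.star θ).1.trans'
        (star_right_left hij fun k => rel_left_right_of_hat h) (star_copy j hy)))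
  rcases lt_trichotomy i j with hij | rfl | hij
  · exact key hij h
  · have := hat_iff.1 h i
    rw [coord_copy, coord_copy] at this
    exact .inl (star_copy i this)
  · rcases key hij ((D.hat θ).1.symm' h) with h' | ⟨h1, h2⟩
    · exact .inl ((D.star θ).1.symm' h')
    · exact .inr ⟨h1.symm, θ.1.symm' h2⟩

/-! ### The role of `β` -/

theorem beta_le_iff : D.beta ≤ θ ↔ ∀ k, θ.1 (D.left k) (D.right k) := by
  have hK := D.two_le_K
  constructor
  · intro h k
    by_cases hk : D.K ∣ k
    · rw [left_eq_right hk]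
    · have hp : 1 ≤ k % D.K := Nat.pos_of_ne_zero fun h0 => hk (Nat.dvd_of_mod_eq_zero h0)
      simp only [left, right, hk, if_false]
      exact h (UCon.Cg_of ⟨_, hp, Nat.mod_lt _ (by omega), rfl, rfl⟩)
  · intro h
    refine UCon.Cg_le ?_
    rintro _ _ ⟨p, hp, hpK, rfl, rfl⟩
    have := h p
    simpa [left, right, Nat.not_dvd_of_pos_of_lt hp hpK, Nat.mod_eq_of_lt hpK] using this

/-- Distinct indices in a block are at least `K` apart, so for each `p` there is an index congruent to
`p` modulo `K` between them, whose coordinate relates `a_p` to `b_p`. -/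
theorem beta_le_of_hat_of_sameBlock {i j : D.Idx} (hij : i < j) (hs : D.SameBlock i j) {x y : B}
    (h : (D.hat θ).1 (D.copy i x) (D.copy j y)) : D.beta ≤ θ := by
  have hK := D.two_le_K
  refine UCon.Cg_le ?_
  rintro _ _ ⟨p, hp, hpK, rfl, rfl⟩
  have hij : (i : ℕ) < j := hij
  have hle : D.K ≤ j - i := Nat.le_of_dvd (by omega) (Nat.dvd_sub hs.dvd hs.symm.dvd)
  have := rel_left_right_of_hat h (k := i + p) (by omega) (by omega)
  have hnd : ¬ D.K ∣ i + p := fun hd =>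
    Nat.not_dvd_of_pos_of_lt hp hpK ((Nat.dvd_add_right hs.symm.dvd).1 hd)
  have hmod : ((i : ℕ) + p) % D.K = p := by
    rw [Nat.add_mod, Nat.mod_eq_zero_of_dvd hs.symm.dvd, Nat.zero_add, Nat.mod_mod,
      Nat.mod_eq_of_lt hpK]
  simpa [left, right, hnd, hmod] using this

theorem star_eq_hat_of_not_beta_le (hβ : ¬ D.beta ≤ θ) : D.star θ = D.hat θ := by
  refine le_antisymm star_le_hat fun {x y} h => ?_
  obtain ⟨i, x, rfl⟩ := exists_copy x
  obtain ⟨j, y, rfl⟩ := exists_copy y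
  rcases star_or_sameBlock_of_hat h with h' | ⟨hs, hxy⟩
  · exact h'
  · rcases lt_trichotomy i j with hij | rfl | hij
    · exact absurd (beta_le_of_hat_of_sameBlock hij hs h) hβ
    · exact star_copy i hxy
    · exact absurd (beta_le_of_hat_of_sameBlock hij hs.symm ((D.hat θ).1.symm' h)) hβ

theorem star_eq_hat_top : D.star ⊤ = D.hat ⊤ := by
  refine le_antisymm star_le_hat fun {x y} _ => ?_
  obtain ⟨i, x, rfl⟩ := exists_copy x
  obtain ⟨j, y, rfl⟩ := exists_copy y
  exact star_of_rel_left (fun _ => trivial) trivial trivial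

open scoped Classical in
/-- The class of `z` in the wedge of the copies of `B/θ`: `none` is the class of the tie-points, and
`some (i, c)` is the class `c` in `B_i`. It is well defined if `β ≤ θ`. -/
noncomputable def wedgeClass (hLR : ∀ k, θ.1 (D.left k) (D.right k)) :
    D.A → Option (D.Idx × Quotient θ.1) :=
  Quot.lift (fun p => if θ.1 p.2 (D.left p.1) then none else some (p.1, Quotient.mk θ.1 p.2)) (by
    rintro _ _ ⟨i, h⟩
    dsimp only
    rw [if_pos (θ.1.symm' (hLR i)), if_pos (θ.1.refl' _)])

/-- If `β ≤ θ`, then `θ*` relates only points of the class of the tie-points and `θ`-related points of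
the same copy. -/
theorem star_copy_cases (hLR : ∀ k, θ.1 (D.left k) (D.right k)) {i j : D.Idx} {x y : B}
    (h : (D.star θ).1 (D.copy i x) (D.copy j y)) :
    (θ.1 x (D.left i) ∧ θ.1 y (D.left j)) ∨ (i = j ∧ θ.1 x y) := by
  classical
  have hE : ∀ k s t, θ.1 s t →
      (Setoid.ker (wedgeClass hLR) ⊓ (D.hat θ).1) (D.copy k s) (D.copy k t) := by
    refine fun k s t hst => ⟨?_, star_le_hat (star_copy k hst)⟩
    change (if θ.1 s (D.left k) then none else some (k, Quotient.mk θ.1 s)) =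
      (if θ.1 t (D.left k) then none else some (k, Quotient.mk θ.1 t))
    rw [Quotient.sound (s := θ.1) hst]
    by_cases hs : θ.1 s (D.left k)
    · rw [if_pos hs, if_pos (θ.1.trans' (θ.1.symm' hst) hs)]
    · rw [if_neg hs, if_neg fun ht => hs (θ.1.trans' hst ht)]
  have hle : D.star θ ≤ conOfBetween _ hE fun _ _ h => h.2 := star_le hE
  have h1 : (if θ.1 x (D.left i) then none else some (i, Quotient.mk θ.1 x)) =
      (if θ.1 y (D.left j) then none else some (j, Quotient.mk θ.1 y)) := (hle h).1
  split_ifs at h1 with hx hy hy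
  · exact .inl ⟨hx, hy⟩
  · simp only [Option.some.injEq, Prod.mk.injEq] at h1
    exact .inr ⟨h1.1, Quotient.exact h1.2⟩

/-! ### The interval between `θ*` and `θ̂` -/

theorem lt_of_mem_part {P : Finset ℕ} (hP : P ∈ D.T.parts) {i : ℕ} (hi : i ∈ P) :
    i < D.u * D.K + 1 := by
  have := D.T.le hP hi
  simp only [Finset.mem_image, Finset.mem_range] at this
  obtain ⟨v, hv, rfl⟩ := this
  exact Nat.lt_succ_of_le (Nat.mul_le_mul_right _ (Nat.le_of_lt_succ hv))

theorem left_eq_of_dvd {k : ℕ} (h : D.K ∣ k) : D.left k = D.a 1 := by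
  simp [left, h]

theorem hat_copy_of_sameBlock (hLR : ∀ k, θ.1 (D.left k) (D.right k)) {i j : D.Idx}
    (hs : D.SameBlock i j) (x : B) : (D.hat θ).1 (D.copy i x) (D.copy j x) := by
  refine hat_iff.2 fun k => ?_
  rw [coord_copy_eq, coord_copy_eq]
  by_cases hk : D.K ∣ (k : ℕ)
  · have : D.SameBlock k i ↔ D.SameBlock k j := by
      obtain ⟨P, hP, hi, hj⟩ := hs
      constructor
      · rintro ⟨Q, hQ, hkQ, hiQ⟩
        exact ⟨P, hP, D.T.eq_of_mem_parts hQ hP hiQ hi ▸ hkQ, hj⟩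
      · rintro ⟨Q, hQ, hkQ, hjQ⟩
        exact ⟨P, hP, D.T.eq_of_mem_parts hQ hP hjQ hj ▸ hkQ, hi⟩
    by_cases hkj : D.SameBlock k j
    · simp only [coordAux, hk, if_true, this.2 hkj, hkj]
      exact θ.1.refl' _
    · simp only [coordAux, hk, if_true, if_neg hkj, if_neg fun h => hkj (this.1 h)]
      exact θ.1.refl' _
  · have h1 := hLR k
    have hki : (i : ℕ) ≠ k := fun e => hk (e ▸ hs.symm.dvd)
    have hkj : (j : ℕ) ≠ k := fun e => hk (e ▸ hs.dvd)
    simp only [left, right, hk, if_false] at h1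
    simp only [coordAux, hk, if_false, hki, hkj]
    split_ifs <;> first | exact θ.1.refl' _ | exact h1 | exact θ.1.symm' h1

/-- If `x` is not in the class of `a₁`, and `i ≠ j` are in the same block, then `x^i` and `x^j` are
related by `θ̂` but not by `θ*`. -/
theorem star_lt_hat_of_two_le_card (hLR : ∀ k, θ.1 (D.left k) (D.right k)) (hθ : θ < ⊤)
    (hT : ∃ P ∈ D.T.parts, 2 ≤ P.card) : D.star θ < D.hat θ := by
  refine lt_of_le_of_ne star_le_hat fun heq => ?_
  obtain ⟨P, hP, hc⟩ := hT
  obtain ⟨i, hi, j, hj, hij⟩ := Finset.one_lt_card.1 hc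
  obtain ⟨x, hx⟩ : ∃ x, ¬ θ.1 x (D.a 1) := by
    by_contra! hall
    exact hθ.not_ge fun {x y} _ => θ.1.trans' (hall x) (θ.1.symm' (hall y))
  have hs : D.SameBlock i j := ⟨P, hP, hi, hj⟩
  have h := hat_copy_of_sameBlock hLR (i := ⟨i, lt_of_mem_part hP hi⟩)
    (j := ⟨j, lt_of_mem_part hP hj⟩) hs x
  rw [← heq] at h
  rcases star_copy_cases hLR h with h' | h'
  · exact hx (left_eq_of_dvd hs.symm.dvd ▸ h'.1)
  · exact hij (congrArg Fin.val h'.1)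

/-- Representatives `c` of the classes of `θ` other than that of `a₁`. -/
theorem exists_representatives [Finite B] (θ : UCon D.F) :
    ∃ c : Fin (θ.numClasses - 1) → B, (∀ m, ¬ θ.1 (c m) (D.a 1)) ∧
      (∀ m n, θ.1 (c m) (c n) → m = n) ∧ ∀ x, ¬ θ.1 x (D.a 1) → ∃ m, θ.1 x (c m) := by
  classical
  have := Fintype.ofFinite (Quotient θ.1)
  let Q := {q : Quotient θ.1 // q ≠ Quotient.mk θ.1 (D.a 1)}
  have hcard : Fintype.card Q = θ.numClasses - 1 := by
    rw [UCon.numClasses, Nat.card_eq_fintype_card]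
    exact Set.card_ne_eq _
  let ε : Q ≃ Fin (θ.numClasses - 1) := Fintype.equivFinOfCardEq hcard
  have hmk : ∀ m, Quotient.mk θ.1 (ε.symm m).1.out = (ε.symm m).1 := fun m => Quotient.out_eq _
  refine ⟨fun m => (ε.symm m).1.out, fun m h => ?_, fun m n h => ?_, fun x hx => ?_⟩
  · exact (ε.symm m).2 ((hmk m).symm.trans (Quotient.sound h))
  · have : Quotient.mk θ.1 (ε.symm m).1.out = Quotient.mk θ.1 (ε.symm n).1.out := Quotient.sound h
    rw [hmk, hmk] at this
    exact ε.symm.injective (Subtype.ext this)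
  · refine ⟨ε ⟨Quotient.mk θ.1 x, fun h => hx (Quotient.exact h)⟩, Quotient.exact ?_⟩
    rw [hmk, Equiv.symm_apply_apply]

/-- The indices in the block `P`, enumerated. -/
noncomputable def blockIdx (P : {P : Finset ℕ // P ∈ D.T.parts}) (k : Fin P.1.card) : D.Idx :=
  ⟨P.1.equivFin.symm k, lt_of_mem_part P.2 (P.1.equivFin.symm k).2⟩

theorem blockIdx_mem (P : {P : Finset ℕ // P ∈ D.T.parts}) (k : Fin P.1.card) :
    (blockIdx P k : ℕ) ∈ P.1 := (P.1.equivFin.symm k).2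

theorem sameBlock_blockIdx (P : {P : Finset ℕ // P ∈ D.T.parts}) (k l : Fin P.1.card) :
    D.SameBlock (blockIdx P k) (blockIdx P l) :=
  ⟨P.1, P.2, blockIdx_mem P k, blockIdx_mem P l⟩

theorem exists_blockIdx {P : {P : Finset ℕ // P ∈ D.T.parts}} {i : D.Idx} (hi : (i : ℕ) ∈ P.1) :
    ∃ k, blockIdx P k = i :=
  ⟨P.1.equivFin ⟨i, hi⟩, Fin.ext (by simp [blockIdx])⟩

theorem blockIdx_injective (P : {P : Finset ℕ // P ∈ D.T.parts}) :
    Function.Injective (blockIdx P) := fun _ _ h =>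
  P.1.equivFin.symm.injective (Subtype.ext (congrArg Fin.val h))

section Interval

variable {ι : Type*} (c : ι → B)

/-- The point of the overalgebra over the `k`-th index of the block `P` and the `m`-th
representative. -/
noncomputable def blockPoint (P : {P : Finset ℕ // P ∈ D.T.parts}) (m : ι) (k : Fin P.1.card) :
    D.A :=
  D.copy (blockIdx P k) (c m)

variable {c}

theorem blockPoint_inj (hLR : ∀ k, θ.1 (D.left k) (D.right k)) (hc : ∀ m, ¬ θ.1 (c m) (D.a 1))
    (hinj : ∀ m n, θ.1 (c m) (c n) → m = n) {P Q : {P : Finset ℕ // P ∈ D.T.parts}} {m n : ι}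
    {k : Fin P.1.card} {l : Fin Q.1.card}
    (h : (D.star θ).1 (blockPoint c P m k) (blockPoint c Q n l)) :
    ∃ hPQ : P = Q, m = n ∧ hPQ ▸ k = l := by
  rcases star_copy_cases hLR h with ⟨h1, -⟩ | ⟨h1, h2⟩
  · rw [left_eq_of_dvd (sameBlock_blockIdx P k k).dvd] at h1
    exact absurd h1 (hc m)
  · obtain rfl : P = Q := Subtype.ext
      (D.T.eq_of_mem_parts P.2 Q.2 (blockIdx_mem P k) (h1 ▸ blockIdx_mem Q l))
    exact ⟨rfl, hinj _ _ h2, blockIdx_injective P h1⟩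

/-- A family of equivalence relations on the blocks, extended to an equivalence relation on `A`
containing `θ*`. -/
def extend (hLR : ∀ k, θ.1 (D.left k) (D.right k)) (hc : ∀ m, ¬ θ.1 (c m) (D.a 1))
    (hinj : ∀ m n, θ.1 (c m) (c n) → m = n)
    (σ : (P : {P : Finset ℕ // P ∈ D.T.parts}) → ι → Setoid (Fin P.1.card)) : Setoid D.A where
  r x y := (D.star θ).1 x y ∨ ∃ P m k l, σ P m k l ∧
    (D.star θ).1 x (blockPoint c P m k) ∧ (D.star θ).1 y (blockPoint c P m l)
  iseqv := by
    have tr {x y z} := (D.star θ).1.trans' (x := x) (y := y) (z := z)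
    have sy {x y} := (D.star θ).1.symm' (x := x) (y := y)
    refine ⟨fun x => .inl ((D.star θ).1.refl' x), ?_, ?_⟩
    · rintro x y (h | ⟨P, m, k, l, h, hx, hy⟩)
      · exact .inl (sy h)
      · exact .inr ⟨P, m, l, k, (σ P m).symm' h, hy, hx⟩
    · rintro x y z (h | ⟨P, m, k, l, h, hx, hy⟩) (h' | ⟨P', m', k', l', h', hx', hy'⟩)
      · exact .inl (tr h h')
      · exact .inr ⟨P', m', k', l', h', tr h hx', hy'⟩
      · exact .inr ⟨P, m, k, l, h, hx, tr (sy h') hy⟩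
      · obtain ⟨rfl, rfl, rfl⟩ := blockPoint_inj hLR hc hinj (tr (sy hy) hx')
        exact .inr ⟨P, m, k, l', (σ P m).trans' h h', hx, hy'⟩

theorem extend_blockPoint (hLR : ∀ k, θ.1 (D.left k) (D.right k)) (hc : ∀ m, ¬ θ.1 (c m) (D.a 1))
    (hinj : ∀ m n, θ.1 (c m) (c n) → m = n)
    (σ : (P : {P : Finset ℕ // P ∈ D.T.parts}) → ι → Setoid (Fin P.1.card))
    (P : {P : Finset ℕ // P ∈ D.T.parts}) (m : ι) (k l : Fin P.1.card) :
    extend hLR hc hinj σ (blockPoint c P m k) (blockPoint c P m l) ↔ σ P m k l := by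
  constructor
  · rintro (h | ⟨P', m', k', l', h, hx, hy⟩)
    · obtain ⟨_, -, rfl⟩ := blockPoint_inj hLR hc hinj h
      exact (σ P m).refl' _
    · obtain ⟨rfl, rfl, rfl⟩ := blockPoint_inj hLR hc hinj hx
      obtain ⟨_, -, rfl⟩ := blockPoint_inj hLR hc hinj hy
      exact h
  · intro h
    exact .inr ⟨P, m, k, l, h, (D.star θ).1.refl' _, (D.star θ).1.refl' _⟩

variable (c) in
/-- The restrictions of a congruence to the families of block points. -/
noncomputable def restrict (η : Set.Icc (D.star θ) (D.hat θ)) (P : {P : Finset ℕ // P ∈ D.T.parts}) (m : ι) :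
    Setoid (Fin P.1.card) :=
  η.1.1.comap (blockPoint c P m)

theorem restrict_le_iff (hLR : ∀ k, θ.1 (D.left k) (D.right k))
    (hsurj : ∀ x, ¬ θ.1 x (D.a 1) → ∃ m, θ.1 x (c m)) {η η' : Set.Icc (D.star θ) (D.hat θ)} :
    restrict c η ≤ restrict c η' ↔ η ≤ η' := by
  constructor
  · intro h x y hxy
    obtain ⟨i, x, rfl⟩ := exists_copy x
    obtain ⟨j, y, rfl⟩ := exists_copy y
    rcases star_or_sameBlock_of_hat (η.2.2 hxy) with hs | ⟨hs, hθ⟩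
    · exact η'.2.1 hs
    · by_cases hx : θ.1 x (D.a 1)
      · -- both points are in the class of the tie-points
        refine η'.2.1 (star_of_rel_left hLR ?_ ?_)
        · rwa [left_eq_of_dvd hs.symm.dvd]
        · rw [left_eq_of_dvd hs.dvd]
          exact θ.1.trans' (θ.1.symm' hθ) hx
      · obtain ⟨m, hm⟩ := hsurj x hx
        have hm' : θ.1 y (c m) := θ.1.trans' (θ.1.symm' hθ) hm
        obtain ⟨P, hP, hi, hj⟩ := hs
        obtain ⟨k, rfl⟩ := exists_blockIdx (P := ⟨P, hP⟩) hi
        obtain ⟨l, rfl⟩ := exists_blockIdx (P := ⟨P, hP⟩) hj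
        have h1 : η.1.1 (blockPoint c ⟨P, hP⟩ m k) (blockPoint c ⟨P, hP⟩ m l) :=
          η.1.1.trans' (η.1.1.symm' (η.2.1 (star_copy _ hm)))
            (η.1.1.trans' hxy (η.2.1 (star_copy _ hm')))
        have h2 : η'.1.1 (blockPoint c ⟨P, hP⟩ m k) (blockPoint c ⟨P, hP⟩ m l) :=
          h ⟨P, hP⟩ m h1
        exact η'.1.1.trans' (η'.2.1 (star_copy _ hm))
          (η'.1.1.trans' h2 (η'.1.1.symm' (η'.2.1 (star_copy _ hm'))))
  · intro h P m k l hkl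
    exact h hkl

theorem restrict_surjective (hLR : ∀ k, θ.1 (D.left k) (D.right k))
    (hc : ∀ m, ¬ θ.1 (c m) (D.a 1)) (hinj : ∀ m n, θ.1 (c m) (c n) → m = n) :
    Function.Surjective (restrict (θ := θ) (D := D) c) := by
  intro σ
  have hle : ∀ x y, extend hLR hc hinj σ x y → (D.hat θ).1 x y := by
    rintro x y (h | ⟨P, m, k, l, -, hx, hy⟩)
    · exact star_le_hat h
    · exact (D.hat θ).1.trans' (star_le_hat hx) ((D.hat θ).1.trans'
        (hat_copy_of_sameBlock hLR (sameBlock_blockIdx P k l) _)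
        ((D.hat θ).1.symm' (star_le_hat hy)))
  refine ⟨⟨conOfBetween (extend hLR hc hinj σ) (fun k s t h => .inl (star_copy k h)) hle,
    fun {x y} h => .inl h, fun {x y} h => hle x y h⟩, ?_⟩
  funext P m
  ext k l
  exact extend_blockPoint hLR hc hinj σ P m k l

end Interval

end LampeData

theorem theorem3 {B : Type*} [Finite B] (D : LampeData B) (θ : UCon D.F)
    (r : ℕ) (hr : θ.numClasses = r) :
    (D.star θ < D.hat θ → D.beta ≤ θ ∧ θ < ⊤) ∧
    ((∃ P ∈ D.T.parts, 2 ≤ P.card) →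
      (D.star θ < D.hat θ ↔ D.beta ≤ θ ∧ θ < ⊤)) ∧
    (D.beta ≤ θ ∧ θ < ⊤ →
      Nonempty (Set.Icc (D.star θ) (D.hat θ) ≃o
        ((P : {P : Finset ℕ // P ∈ D.T.parts}) → Fin (r - 1) → Setoid (Fin P.1.card)))) ∧
    (¬ D.beta ≤ θ → D.star θ = D.hat θ) := by
  have h1 : D.star θ < D.hat θ → D.beta ≤ θ ∧ θ < ⊤ := by
    intro h
    constructor
    · by_contra hβ
      exact h.ne (LampeData.star_eq_hat_of_not_beta_le hβ)
    · refine lt_top_iff_ne_top.2 ?_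
      rintro rfl
      exact h.ne LampeData.star_eq_hat_top
  refine ⟨h1, fun hT => ⟨h1, fun h => ?_⟩, fun h => ?_, LampeData.star_eq_hat_of_not_beta_le⟩
  · exact LampeData.star_lt_hat_of_two_le_card (LampeData.beta_le_iff.1 h.1) h.2 hT
  · subst hr
    have hLR := LampeData.beta_le_iff.1 h.1
    obtain ⟨c, hc, hinj, hsurj⟩ := LampeData.exists_representatives θ
    exact ⟨RelIso.ofSurjective
      (OrderEmbedding.ofMapLEIff (LampeData.restrict c)
        fun _ _ => LampeData.restrict_le_iff hLR hsurj)
      (LampeData.restrict_surjective hLR hc hinj)⟩
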